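/- Let $\mathbb{F}$ be a finite field. For integers $1\le k\le n$ and $\beta\in\mathbb{F}^n$, let $\mathrm{wt}_k(\beta)$ be the least number of $k$-element subsets of $[1,n]=\{1,\dots,n\}$ whose union contains the support $\{i:\beta_i\ne 0\}$ of $\beta$. Let $\mathcal{CO}(\mathbb{F}^n,\mathcal{P}(k,[1,n]))$ be the partition of $\mathbb{F}^n$ in which two vectors belong to the same class if and only if they have the same weight $\mathrm{wt}_k$. A partition $\Delta$ of $\mathbb{F}^n$ *satisfies the MEP* (MacWilliams extension property) if for every linear subspace $C\subseteq\mathbb{F}^n$ and every injective $\mathbb{F}$-linear map $g:C\to\mathbb{F}^n$ such that $\alpha$ and $g(\alpha)$ lie in the same class of $\Delta$ for all $\alpha\in C$, there is an $\mathbb{F}$-linear automorphism $\varphi$ of $\mathbb{F}^n$ such that $\varphi|_C=g$ and $\beta$ and $\varphi(\beta)$ lie in the same class of $\Delta$ for all $\beta\in\mathbb{F}^n$. **Theorem 5.3.** 1. Suppose that $|\mathbb{F}|=2$. Then for every integer $n\ge 5$, $\mathcal{CO}(\mathbb{F}^n,\mathcal{P}(3,[1,n]))$ does not satisfy the MEP.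 Moreover, for every integer $k\ge 4$: - there exists a positive integer $m$ such that $\mathcal{CO}(\mathbb{F}^n,\mathcal{P}(k,[1,n]))$ does not satisfy the MEP for any integer $n$ with $n\ge m$ and $n\ge k+1$; - $\mathcal{CO}(\mathbb{F}^n,\mathcal{P}(k,[1,n]))$ does not satisfy the MEP for any integer $n$ with $k+2\le n\le 2k$; - if $k$ is odd, $\mathcal{CO}(\mathbb{F}^n,\mathcal{P}(k,[1,n]))$ does not satisfy the MEP for any integer $n$ with $\max\{k+2,7\}\le n\le 5k$. 2. Suppose that $|\mathbb{F}|\ge 3$. Then for every integer $n\ge 3$, $\mathcal{CO}(\mathbb{F}^n,\mathcal{P}(2,[1,n]))$ does not satisfy the MEP. Moreover, for every integer $k\ge 3$: - there exists a positive integer $m$ such that $\mathcal{CO}(\mathbb{F}^n,\mathcal{P}(k,[1,n]))$ does not satisfy the MEP for any integer $n$ with $n\ge m$ and $n\ge k+1$; - $\mathcal{CO}(\mathbb{F}^{k+2},\mathcal{P}(k,[1,k+2]))$ does not satisfy the MEP; - $\mathcal{CO}(\mathbb{F}^n,\mathcal{P}(k,[1,n]))$ does not satisfy the MEP for any integer $n\ge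 k+1$ with $n\equiv 1\pmod{k}$. -/

import Mathlib

/-- `T` is a covering of `Ω`: a collection of subsets of `Ω` whose union is `Ω`. -/
def IsCovering {Ω : Type*} (T : Set (Set Ω)) : Prop :=
  ⋃₀ T = Set.univ

/-- `ω_T(A)`: the least number of members of the collection `T` whose union contains `A`.
For a covering `T` of a finite set this is a minimum over a nonempty set of natural numbers. -/
noncomputable def coveringWeight {Ω : Type*} (T : Set (Set Ω)) (A : Set Ω) : ℕ :=
  sInf {c : ℕ | ∃ S : Finset (Set Ω), (S : Set (Set Ω)) ⊆ T ∧ A ⊆ ⋃₀ (S : Set (Set Ω)) ∧ S.card = c}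

/-- `P(r, Ω)`: the collection of all subsets of the finite set `Ω` with cardinality `r`. -/
def subsetsOfCard (r : ℕ) (Ω : Type*) [Finite Ω] : Set (Set Ω) :=
  {A : Set Ω | A.ncard = r}

/-- The `T`-weight `wt_T(β) = ω_T(supp β)` of a word `β`. -/
noncomputable def combWeight {Ω X : Type*} [Zero X] (T : Set (Set Ω)) (β : Ω → X) : ℕ :=
  coveringWeight T (Function.support β)

/-- `CO(X^Ω, T)`: the partition of `X^Ω` (given by its equivalence relation) in which two words lie
in the same class if and only if they have the same `T`-weight. -/
def CO (X : Type*) [Zero X] {Ω : Type*} (T : Set (Set Ω)) : Setoid (Ω → X) where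
  r β θ := combWeight T β = combWeight T θ
  iseqv := ⟨fun _ => rfl, fun h => h.symm, fun h h' => h.trans h'⟩

/-- `Inv(Δ)`: the group of all linear automorphisms `σ` of `V` such that `β` and `σ β` belong to
the same class of the partition `Δ` for all `β`. -/
def invGroup (F : Type*) {V : Type*} [Field F] [AddCommGroup V] [Module F V] (Δ : Setoid V) :
    Subgroup (V ≃ₗ[F] V) where
  carrier := {σ | ∀ β : V, Δ β (σ β)}
  one_mem' := fun β => Δ.refl β
  mul_mem' := fun {_ τ} hσ hτ β => Δ.trans (hτ β) (hσ (τ β))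
  inv_mem' := fun {σ} hσ β => by
    have h := hσ (σ⁻¹ β)
    have e : σ (σ⁻¹ β) = β := σ.apply_symm_apply β
    rw [e] at h
    exact Δ.symm h

/-- The MacWilliams extension property of a partition `Δ` of a vector space `V`: every injective
linear map `g` from a linear code `C ⊆ V` to `V` which preserves the classes of `Δ` is the
restriction of an element of `Inv(Δ)`. -/
def SatisfiesMEP (F : Type*) {V : Type*} [Field F] [AddCommGroup V] [Module F V]
    (Δ : Setoid V) : Prop :=
  ∀ (C : Submodule F V) (g : C →ₗ[F] V), Function.Injective g →
    (∀ α : C, Δ (α : V) (g α)) →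
      ∃ φ ∈ invGroup F Δ, ∀ α : C, φ (α : V) = g α

/-- If `1 ≤ r ≤ |Ω|`, then `P(r, Ω)` is a covering of `Ω`. -/
theorem isCovering_subsetsOfCard {Ω : Type*} [Finite Ω] {r : ℕ} (h1 : 1 ≤ r)
    (h2 : r ≤ Nat.card Ω) : IsCovering (subsetsOfCard r Ω) := by
  refine Set.eq_univ_of_forall fun x => ?_
  obtain ⟨A, hxA, -, hA⟩ := Set.exists_subsuperset_card_eq (s := {x}) (t := Set.univ) (n := r)
    (Set.subset_univ _) (by simpa using h1) (by simpa [Set.ncard_univ] using h2)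
  exact ⟨A, hA, hxA rfl⟩

/-- For a covering of a finite set the minimum that defines `ω_T(A)` is attained. -/
theorem exists_card_eq_coveringWeight {Ω : Type*} [Finite Ω] {T : Set (Set Ω)} (hT : IsCovering T)
    (A : Set Ω) : ∃ S : Finset (Set Ω), (S : Set (Set Ω)) ⊆ T ∧ A ⊆ ⋃₀ (S : Set (Set Ω)) ∧
      S.card = coveringWeight T A := by
  refine Nat.sInf_mem (s := {c : ℕ | ∃ S : Finset (Set Ω), (S : Set (Set Ω)) ⊆ T ∧
    A ⊆ ⋃₀ (S : Set (Set Ω)) ∧ S.card = c}) ⟨_, (Set.toFinite T).toFinset, ?_, ?_, rfl⟩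
  · simp
  · have h : ⋃₀ T = Set.univ := hT
    simp [h]

section Weight

open Finset

variable {F : Type*} [Field F] {n k : ℕ}

/-! All nonzero words of Hamming norm at most `k` form a single weight class, the class of weight 1.
Under the MEP, the map between the lines spanned by two such words extends to an automorphism
preserving the radius-`k` Hamming ball `B` about 0, so `#(B ∩ (a + B))` is constant on this class
(`SatisfiesMEP.card_ballInter_eq`). Enlarging the support of `a` by one coordinate makes this number
drop strictly once a suitable boundary word `c` exists (`card_ballInter_add_single_lt`). Every case
of the theorem then reduces to exhibiting `a` and `c`. -/

theorem combWeight_eq_zero_iff (hk : 1 ≤ k) (hkn : k ≤ n) (β : Fin n → F) :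
    combWeight (subsetsOfCard k (Fin n)) β = 0 ↔ β = 0 := by
  constructor
  · intro h
    obtain ⟨S, -, hcov, hcard⟩ := exists_card_eq_coveringWeight
      (isCovering_subsetsOfCard hk (by simpa using hkn)) (Function.support β)
    have hS : S = ∅ := Finset.card_eq_zero.mp (hcard.trans h)
    subst hS
    simpa using hcov
  · rintro rfl
    exact Nat.sInf_eq_zero.mpr (Or.inl ⟨∅, by simp, by simp, by simp⟩)

variable [DecidableEq F]

theorem combWeight_le_one_iff (hk : 1 ≤ k) (hkn : k ≤ n) (β : Fin n → F) :
    combWeight (subsetsOfCard k (Fin n)) β ≤ 1 ↔ hammingNorm β ≤ k := by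
  have hnorm : hammingNorm β = (Function.support β).ncard := by
    rw [hammingNorm, ← Set.ncard_coe_finset]
    congr 1
    ext i
    simp
  rw [hnorm]
  constructor
  · intro h
    obtain ⟨S, hST, hcov, hcard⟩ := exists_card_eq_coveringWeight
      (isCovering_subsetsOfCard hk (by simpa using hkn)) (Function.support β)
    have hS : #S ≤ 1 := hcard.trans_le h
    rcases Finset.card_le_one_iff_subset_singleton.mp hS with ⟨A, hA⟩
    rcases Finset.subset_singleton_iff.mp hA with rfl | rfl
    · have : Function.support β = ∅ := by simpa using hcov
      simp [this]
    · have hAk : A.ncard = k := hST (by simp)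
      rw [← hAk]
      exact Set.ncard_le_ncard (by simpa using hcov) (Set.toFinite _)
  · intro h
    obtain ⟨A, hβA, -, hA⟩ := Set.exists_subsuperset_card_eq (t := Set.univ)
      (Set.subset_univ (Function.support β)) h (by simpa [Set.ncard_univ] using hkn)
    exact Nat.sInf_le ⟨{A}, by simpa [subsetsOfCard] using hA, by simpa using hβA, by simp⟩

theorem combWeight_eq_one (hk : 1 ≤ k) (hkn : k ≤ n) {β : Fin n → F} (h0 : β ≠ 0)
    (h : hammingNorm β ≤ k) : combWeight (subsetsOfCard k (Fin n)) β = 1 := by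
  have h1 := (combWeight_le_one_iff hk hkn β).mpr h
  have h2 := (combWeight_eq_zero_iff hk hkn β).not.mpr h0
  omega

theorem hammingNorm_eq_update_add (β : Fin n → F) (i : Fin n) :
    hammingNorm β = hammingNorm (Function.update β i 0) + if β i = 0 then 0 else 1 := by
  have h : (univ.filter fun j => Function.update β i 0 j ≠ 0)
      = (univ.filter fun j => β j ≠ 0).erase i := by
    ext j
    by_cases hj : j = i
    · subst hj; simp
    · simp [hj]
  unfold hammingNorm
  rw [h]
  split_ifs with h0
  · rw [Finset.erase_eq_of_notMem (by simpa using h0)]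
    rfl
  · rw [Finset.card_erase_add_one (by simpa using h0)]

theorem hammingNorm_eq_card {β : Fin n → F} (S : Finset ℕ) (hS : S ⊆ range n)
    (h : ∀ j : Fin n, β j ≠ 0 ↔ (j : ℕ) ∈ S) : hammingNorm β = #S := by
  unfold hammingNorm
  rw [← Finset.card_map Fin.valEmbedding]
  congr 1
  ext x
  simp only [Finset.mem_map, Finset.mem_filter, Finset.mem_univ, true_and, Fin.valEmbedding_apply]
  constructor
  · rintro ⟨j, hj, rfl⟩
    exact (h j).mp hj
  · intro hx
    exact ⟨⟨x, Finset.mem_range.mp (hS hx)⟩, (h _).mpr hx, rfl⟩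

variable [Fintype F]

/-- The words within Hamming distance `k` of both `0` and `a`. -/
def ballInter (k : ℕ) (a : Fin n → F) : Finset (Fin n → F) :=
  univ.filter fun β => hammingNorm β ≤ k ∧ hammingNorm (β - a) ≤ k

theorem mem_ballInter {a β : Fin n → F} :
    β ∈ ballInter k a ↔ hammingNorm β ≤ k ∧ hammingNorm (β - a) ≤ k := by
  simp [ballInter]

/-- The number of words near both `0` and `a` depends only on the orbit of `a` under the
automorphisms that preserve the weight classes. -/
theorem card_ballInter_eq_of_mem_invGroup (hk : 1 ≤ k) (hkn : k ≤ n)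
    {φ : (Fin n → F) ≃ₗ[F] (Fin n → F)}
    (hφ : φ ∈ invGroup F (CO F (subsetsOfCard k (Fin n)))) (a : Fin n → F) :
    #(ballInter k a) = #(ballInter k (φ a)) := by
  have key : ∀ β, hammingNorm (φ β) ≤ k ↔ hammingNorm β ≤ k := fun β => by
    have h : combWeight _ β = combWeight _ (φ β) := hφ β
    rw [← combWeight_le_one_iff hk hkn, ← combWeight_le_one_iff hk hkn, h]
  refine Finset.card_equiv φ.toEquiv fun β => ?_
  simp only [mem_ballInter, LinearEquiv.coe_toEquiv, ← map_sub, key]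

/-- Under the MEP, two nonzero words of Hamming weight at most `k` are conjugate, so their balls
intersect the ball around `0` in equally many words. -/
theorem SatisfiesMEP.card_ballInter_eq (hk : 1 ≤ k) (hkn : k ≤ n)
    (hM : SatisfiesMEP F (CO F (subsetsOfCard k (Fin n)))) {a b : Fin n → F}
    (ha : a ≠ 0) (hb : b ≠ 0) (hak : hammingNorm a ≤ k) (hbk : hammingNorm b ≤ k) :
    #(ballInter k a) = #(ballInter k b) := by
  have hsmul : ∀ (c : F) (β : Fin n → F), c ≠ 0 → hammingNorm (c • β) = hammingNorm β :=
    fun c β hc => hammingNorm_smul (fun _ => (isUnit_iff_ne_zero.mpr hc).isSMulRegular _) β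
  -- The code is the line through `a`, and the map to be extended sends `t • a` to `t • b`.
  let e := LinearEquiv.coord F (Fin n → F) a ha
  let g : Submodule.span F {a} →ₗ[F] (Fin n → F) :=
    (LinearMap.toSpanSingleton F (Fin n → F) b).comp e.toLinearMap
  have hg : ∀ α, g α = e α • b := fun α => rfl
  have hα : ∀ α : Submodule.span F {a}, e α • a = α := fun α =>
    LinearEquiv.coord_apply_smul F (Fin n → F) a ha α
  have hinj : Function.Injective g := by
    intro x y hxy
    rw [hg, hg] at hxy
    exact e.injective (smul_left_injective F hb hxy)
  obtain ⟨φ, hφ, hext⟩ := hM _ g hinj fun α => by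
    change combWeight _ _ = combWeight _ _
    rw [hg, ← hα α]
    generalize e α = t
    by_cases h0 : t = 0
    · simp [h0]
    · rw [combWeight_eq_one hk hkn (smul_ne_zero h0 ha) (by rwa [hsmul _ _ h0]),
        combWeight_eq_one hk hkn (smul_ne_zero h0 hb) (by rwa [hsmul _ _ h0])]
  have hab : φ a = b := by
    have h := hext ⟨a, Submodule.mem_span_singleton_self a⟩
    rw [hg] at h
    have h1 : e ⟨a, Submodule.mem_span_singleton_self a⟩ = 1 :=
      LinearEquiv.coord_self F (Fin n → F) a ha
    rwa [h1, one_smul] at h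
  rw [card_ballInter_eq_of_mem_invGroup hk hkn hφ a, hab]

/-- Subtracting the unit vector at `i` injects the words lost from `a` to `a + Pi.single i 1` in
reverse: those gained go to those lost. Every image has norm below `k`, so the lost word `c`, of
norm exactly `k`, is missed. -/
theorem card_ballInter_add_single_lt {a c : Fin n → F} {i : Fin n} (hai : a i = 0)
    (hci : c i = 0) (hc : hammingNorm c = k) (hca : hammingNorm (c - a) = k) :
    #(ballInter k (a + Pi.single i 1)) < #(ballInter k a) := by
  classical
  set b : Fin n → F := a + Pi.single i 1 with hb
  have hupd : ∀ β : Fin n → F,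
      Function.update (β - b) i 0 = Function.update (β - a) i 0 := by
    intro β
    ext j
    by_cases hj : j = i
    · subst hj; simp
    · simp [hb, hj]
  have hshift : ∀ β : Fin n → F, β - Pi.single i 1 - a = β - b := by
    intro β
    rw [hb]
    abel
  have hbi : b i = 1 := by simp [hb, hai]
  rw [← Finset.card_sdiff_lt_card_sdiff_iff]
  have hchar : ∀ β ∈ ballInter k b \ ballInter k a,
      hammingNorm (β - Pi.single i 1) < k ∧ β - Pi.single i 1 ∈ ballInter k a \ ballInter k b := by
    intro β hβ
    rw [Finset.mem_sdiff, mem_ballInter, mem_ballInter] at hβ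
    obtain ⟨⟨h1, h2⟩, h3⟩ := hβ
    replace h3 : k < hammingNorm (β - a) := by
      by_contra h
      exact h3 ⟨h1, not_lt.mp h⟩
    have hA := hammingNorm_eq_update_add (β - a) i
    have hB := hammingNorm_eq_update_add (β - b) i
    rw [hupd] at hB
    -- Otherwise coordinate `i` already counts fully in the distance to `b`, and `β` would be no
    -- farther from `a` than from `b`.
    have hβi : β i = 1 := by
      by_contra h
      have : (β - b) i ≠ 0 := by simpa [hbi, sub_eq_zero] using h
      rw [if_neg this] at hB
      split_ifs at hA <;> omega
    have hC := hammingNorm_eq_update_add β i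
    rw [if_neg (by simp [hβi])] at hC
    have hD : Function.update β i 0 = β - Pi.single i 1 := by
      ext j
      by_cases hj : j = i
      · subst hj; simp [hβi]
      · simp [hj]
    rw [hD] at hC
    have hE := hammingNorm_eq_update_add (β - Pi.single i 1 - b) i
    have hG : Function.update (β - Pi.single i 1 - b) i 0 = Function.update (β - a) i 0 := by
      ext j
      by_cases hj : j = i
      · subst hj; simp
      · simp [hb, hj]
    rw [hG, if_neg (by simp [hβi, hbi])] at hE
    have hI : (if (β - a) i = 0 then 0 else 1) ≤ 1 := by split_ifs <;> omega
    rw [Finset.mem_sdiff, mem_ballInter, mem_ballInter, hshift]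
    refine ⟨by omega, ⟨by omega, h2⟩, fun h => ?_⟩
    have := h.2
    omega
  have hcmem : c ∈ ballInter k a \ ballInter k b := by
    rw [Finset.mem_sdiff, mem_ballInter, mem_ballInter]
    refine ⟨⟨hc.le, hca.le⟩, fun h => ?_⟩
    have hA := hammingNorm_eq_update_add (c - a) i
    have hB := hammingNorm_eq_update_add (c - b) i
    rw [if_pos (by simp [hci, hai])] at hA
    rw [hupd, if_neg (by simp [hci, hbi])] at hB
    have := h.2
    omega
  calc #(ballInter k b \ ballInter k a)
      = #((ballInter k b \ ballInter k a).image (· - Pi.single i 1)) :=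
        (Finset.card_image_of_injective _ (sub_left_injective)).symm
    _ < #(ballInter k a \ ballInter k b) := by
        refine Finset.card_lt_card ⟨?_, fun h => ?_⟩
        · intro x hx
          obtain ⟨β, hβ, rfl⟩ := Finset.mem_image.mp hx
          exact (hchar β hβ).2
        · obtain ⟨β, hβ, hβc⟩ := Finset.mem_image.mp (h hcmem)
          have := (hchar β hβ).1
          rw [hβc] at this
          omega

/-- The strict bound on the norm of `a` leaves room for one more coordinate, keeping `a + Pi.single
i 1` in the class of weight 1. -/
theorem not_satisfiesMEP_of_exists {a c : Fin n → F} {i : Fin n} (hk : 1 ≤ k) (hkn : k ≤ n)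
    (ha : a ≠ 0) (hak : hammingNorm a < k) (hai : a i = 0) (hci : c i = 0)
    (hc : hammingNorm c = k) (hca : hammingNorm (c - a) = k) :
    ¬ SatisfiesMEP F (CO F (subsetsOfCard k (Fin n))) := by
  intro hM
  have hbi : (a + Pi.single i 1 : Fin n → F) i = 1 := by simp [hai]
  have hb0 : (a + Pi.single i 1 : Fin n → F) ≠ 0 := fun h => by
    rw [h] at hbi
    exact zero_ne_one hbi
  have hbk : hammingNorm (a + Pi.single i 1 : Fin n → F) ≤ k := by
    have h := hammingNorm_eq_update_add (a + Pi.single i 1 : Fin n → F) i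
    have hu : Function.update (a + Pi.single i 1 : Fin n → F) i 0 = a := by
      ext j
      by_cases hj : j = i
      · subst hj; simp [hai]
      · simp [hj]
    rw [hu, if_neg (by simp [hai])] at h
    omega
  exact (card_ballInter_add_single_lt hai hci hc hca).ne'
    (hM.card_ballInter_eq hk hkn ha hb0 hak.le hbk)

/-- Only the scalars 0 and 1 are used, so `a` needs two ones: `c` meets its support in one of them,
and subtracting `a` swaps which one. With `k - 1` further ones and the free coordinate 2, this takes
`k + 2` coordinates. -/
theorem not_satisfiesMEP_of_three_le {F : Type*} [Field F] [Finite F] {n k : ℕ} (hk : 3 ≤ k)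
    (hn : k + 2 ≤ n) : ¬ SatisfiesMEP F (CO F (subsetsOfCard k (Fin n))) := by
  classical
  have := Fintype.ofFinite F
  let a : Fin n → F := fun j => if (j : ℕ) < 2 then 1 else 0
  let c : Fin n → F := fun j =>
    if (j : ℕ) = 0 ∨ 3 ≤ (j : ℕ) ∧ (j : ℕ) < k + 2 then 1 else 0
  have ha : hammingNorm a = 2 := by
    rw [hammingNorm_eq_card (range 2) (by grind) (by intro j; simp [a])]
    simp
  have hpair : ∀ x < 2, #(range (k + 2) \ {x, 2}) = k := by
    intro x hx
    rw [Finset.card_sdiff_of_subset (by grind), Finset.card_pair (by omega)]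
    simp
  refine not_satisfiesMEP_of_exists (a := a) (c := c) (i := ⟨2, by omega⟩) (by omega) (by omega)
    ?_ (by omega) (by simp [a]) (by simp [c]) ?_ ?_
  · exact hammingNorm_ne_zero_iff.mp (by omega)
  · rw [hammingNorm_eq_card (range (k + 2) \ {1, 2}) (by grind) ?_, hpair 1 (by omega)]
    intro j
    simp only [c, ne_eq, ite_eq_right_iff, one_ne_zero, imp_false, not_not, Finset.mem_sdiff,
      Finset.mem_range, Finset.mem_insert, Finset.mem_singleton]
    omega
  · rw [hammingNorm_eq_card (range (k + 2) \ {0, 2}) (by grind) ?_, hpair 0 (by omega)]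
    intro j
    simp only [Finset.mem_sdiff, Finset.mem_range, Finset.mem_insert, Finset.mem_singleton,
      Pi.sub_apply, a, c]
    split_ifs <;> simp <;> omega

/-- A scalar `t` other than 0 and 1 lets `c` and `c - a` have the same support with `a` a unit
vector, which saves one coordinate. -/
theorem not_satisfiesMEP_of_three_le_card {F : Type*} [Field F] [Finite F]
    (hF : 3 ≤ Nat.card F) {n k : ℕ} (hk : 2 ≤ k) (hn : k + 1 ≤ n) :
    ¬ SatisfiesMEP F (CO F (subsetsOfCard k (Fin n))) := by
  classical
  have := Fintype.ofFinite F
  obtain ⟨t, ht⟩ : ∃ t : F, t ∉ ({0, 1} : Finset F) := by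
    refine Finset.exists_mem_notMem_of_card_lt_card (s := {0, 1}) (t := univ) ?_ |>.imp
      fun _ h => h.2
    rw [Finset.card_univ, ← Nat.card_eq_fintype_card]
    exact Finset.card_le_two.trans_lt hF
  have ht0 : t ≠ 0 := by rintro rfl; simp at ht
  have ht1 : t - 1 ≠ 0 := by
    intro h
    rw [sub_eq_zero] at h
    simp [h] at ht
  let a : Fin n → F := fun j => if (j : ℕ) < 1 then 1 else 0
  let c : Fin n → F := fun j =>
    if (j : ℕ) = 0 then t else if 2 ≤ (j : ℕ) ∧ (j : ℕ) < k + 1 then 1 else 0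
  have ha : hammingNorm a = 1 := by
    rw [hammingNorm_eq_card (range 1) (by grind) (by intro j; simp [a])]
    simp
  have hcard : #((range (k + 1)).erase 1) = k := by
    rw [Finset.card_erase_of_mem (by simp; omega)]
    simp
  refine not_satisfiesMEP_of_exists (a := a) (c := c) (i := ⟨1, by omega⟩) (by omega) (by omega)
    ?_ (by omega) (by simp [a]) (by simp [c]) ?_ ?_
  · exact hammingNorm_ne_zero_iff.mp (by omega)
  · rw [hammingNorm_eq_card ((range (k + 1)).erase 1) (by grind) ?_, hcard]
    intro j
    simp only [Finset.mem_erase, Finset.mem_range, c]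
    split_ifs <;> simp [ht0] <;> omega
  · rw [hammingNorm_eq_card ((range (k + 1)).erase 1) (by grind) ?_, hcard]
    intro j
    simp only [Finset.mem_erase, Finset.mem_range, Pi.sub_apply, a, c]
    split_ifs <;> simp [ht1] <;> omega

end Weight

theorem theorem5p3 {F : Type*} [Field F] [Finite F] :
    (Nat.card F = 2 →
      (∀ n : ℕ, 5 ≤ n → ¬ SatisfiesMEP F (CO F (subsetsOfCard 3 (Fin n)))) ∧
      (∀ k : ℕ, 4 ≤ k →
        (∃ m : ℕ, 0 < m ∧ ∀ n : ℕ, m ≤ n → k + 1 ≤ n →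
          ¬ SatisfiesMEP F (CO F (subsetsOfCard k (Fin n)))) ∧
        (∀ n : ℕ, k + 2 ≤ n → n ≤ 2 * k →
          ¬ SatisfiesMEP F (CO F (subsetsOfCard k (Fin n)))) ∧
        (¬ 2 ∣ k → ∀ n : ℕ, max (k + 2) 7 ≤ n → n ≤ 5 * k →
          ¬ SatisfiesMEP F (CO F (subsetsOfCard k (Fin n)))))) ∧
    (3 ≤ Nat.card F →
      (∀ n : ℕ, 3 ≤ n → ¬ SatisfiesMEP F (CO F (subsetsOfCard 2 (Fin n)))) ∧
      (∀ k : ℕ, 3 ≤ k →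
        (∃ m : ℕ, 0 < m ∧ ∀ n : ℕ, m ≤ n → k + 1 ≤ n →
          ¬ SatisfiesMEP F (CO F (subsetsOfCard k (Fin n)))) ∧
        ¬ SatisfiesMEP F (CO F (subsetsOfCard k (Fin (k + 2)))) ∧
        (∀ n : ℕ, k + 1 ≤ n → n ≡ 1 [MOD k] →
          ¬ SatisfiesMEP F (CO F (subsetsOfCard k (Fin n)))))) := by
  refine ⟨fun _ => ⟨fun n hn => not_satisfiesMEP_of_three_le le_rfl hn, fun k hk => ⟨⟨k + 2,
    by omega, fun n hn _ => not_satisfiesMEP_of_three_le (by omega) hn⟩,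
    fun n hn _ => not_satisfiesMEP_of_three_le (by omega) hn,
    fun _ n hn _ => not_satisfiesMEP_of_three_le (by omega) (le_of_max_le_left hn)⟩⟩,
    fun hF => ⟨fun n hn => not_satisfiesMEP_of_three_le_card hF le_rfl hn, fun k hk => ⟨⟨1,
    one_pos, fun n _ hn => not_satisfiesMEP_of_three_le_card hF (by omega) hn⟩,
    not_satisfiesMEP_of_three_le_card hF (by omega) (by omega),
    fun n hn _ => not_satisfiesMEP_of_three_le_card hF (by omega) hn⟩⟩⟩
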